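/- Let $X, Z \subset \mathbb{R}$ be compact, let $\sigma_X$ and $\sigma_Z$ be Borel probability measures on $\mathbb{R}$ concentrated on $X$ and $Z$ respectively, and let $\bar z = \int z \, d\sigma_Z(z)$. Let $\overline{\Pi}(\sigma_X,\sigma_Z)$ be the set of couplings $\pi$ of $\sigma_X$ and $\sigma_Z$ that can be written $\pi = \sigma_X \otimes \kappa$, with $\kappa$ a probability kernel, such that $\int z \, \kappa(x, dz) = \bar z$ for $\sigma_X$-almost every $x$. Let $c \in C(X \times Z)$ be differentiable in $x$ (relative to $X$, so one-sidedly at endpoints) for every $z \in Z$, and suppose that $c$ satisfies the martingale Spence–Mirrlees condition, that is, either (a) $X$ is a (nondegenerate) interval and $z \mapsto \partial_x c(x,z)$ is strictly concave on $Z$ for every $x \in X$; or, more generally, (b) $z \mapsto c(x',z) - c(x,z)$ is strictly concave on $Z$ for all $x < x'$ in $X$. Here a function $f$ is called strictly concave on $Z$ (which need not be convex) if $f((1-\lambda) z_0 + \lambda z_1) > (1-\lambda) f(z_0) + \lambda f(z_1)$ whenever $z_0 \neq z_1$ and $(1-\lambda) z_0 + \lambda z_1$ belong to $Z$, with $z_0,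 z_1 \in Z$ and $0<\lambda<1$. Theorem. If $\pi$ is a minimizer of $\int c \, d\pi$ over $\overline{\Pi}(\sigma_X,\sigma_Z)$, then $\pi$ is left-monotone: whenever $(x,z^-), (x,z^+), (x',z')$ belong to the topological support of $\pi$ with $z^- < z^+$ and $x < x'$, one has $z' \notin (z^-, z^+)$. -/

import Mathlib

open MeasureTheory ProbabilityTheory Set

/-- `Π(μ, ν)`: measures on the plane whose first marginal is `μ` and second marginal is `ν`. -/
def couplings (μ ν : Measure ℝ) : Set (Measure (ℝ × ℝ)) :=
  {π | π.map Prod.fst = μ ∧ π.map Prod.snd = ν}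

/-- `Π_F(μ, ν)`: the couplings `π = μ ⊗ κ` of `μ` and `ν` whose conditional barycenter
`∫ z κ(x, dz)` equals `F x` for `μ`-almost every `x`. -/
def barycenterCouplings (F : ℝ → ℝ) (μ ν : Measure ℝ) : Set (Measure (ℝ × ℝ)) :=
  {π | π ∈ couplings μ ν ∧ ∃ κ : Kernel ℝ ℝ, IsMarkovKernel κ ∧ π = μ ⊗ₘ κ ∧
    ∀ᵐ x ∂μ, Integrable (fun z => z) (κ x) ∧ ∫ z, z ∂(κ x) = F x}

/-- `π` solves the fixed-barycenter problem: it minimizes `∫ c dπ` over the couplings of `μ` and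
`ν` whose conditional barycenter is constantly equal to the mean of `ν`. -/
def IsFixedBarycenterOptimal (c : ℝ → ℝ → ℝ) (μ ν : Measure ℝ) (π : Measure (ℝ × ℝ)) : Prop :=
  π ∈ barycenterCouplings (fun _ => ∫ z, z ∂ν) μ ν ∧
    ∀ π' ∈ barycenterCouplings (fun _ => ∫ z, z ∂ν) μ ν,
      ∫ p, c p.1 p.2 ∂π ≤ ∫ p, c p.1 p.2 ∂π'

/-- Strict concavity of a function on a subset `Z` of the line that need not be convex: the strict
Jensen inequality at every point of `Z` strictly between two points of `Z`. For convex `Z` this is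
`StrictConcaveOn ℝ Z f`. -/
def StrictlyConcaveAlong (Z : Set ℝ) (f : ℝ → ℝ) : Prop :=
  ∀ z₀ ∈ Z, ∀ z₁ ∈ Z, z₀ ≠ z₁ → ∀ l : ℝ, 0 < l → l < 1 → (1 - l) * z₀ + l * z₁ ∈ Z →
    (1 - l) * f z₀ + l * f z₁ < f ((1 - l) * z₀ + l * z₁)

/-- The martingale Spence–Mirrlees condition for a cost `c` on `X × Z`: either `X` is an interval
and the partial derivative of `c` in its first variable is strictly concave in the second one, or,
more generally and for any `X`, the increments `c x' z - c x z` with `x < x'` are strictly concave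
in `z`. -/
def MartingaleSpenceMirrlees (X Z : Set ℝ) (c : ℝ → ℝ → ℝ) : Prop :=
  (X.OrdConnected ∧
    ∀ x ∈ X, StrictlyConcaveAlong Z (fun z => derivWithin (fun t => c t z) X x)) ∨
  (∀ x ∈ X, ∀ x' ∈ X, x < x' → StrictlyConcaveAlong Z (fun z => c x' z - c x z))

/-- The no-crossing condition for a subset of the plane. -/
def IsLeftMonotoneSet (Γ : Set (ℝ × ℝ)) : Prop :=
  ∀ x zm zp x' z' : ℝ, (x, zm) ∈ Γ → (x, zp) ∈ Γ → (x', z') ∈ Γ → zm < zp → x < x' →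
    z' ∉ Ioo zm zp

/-- A measure on the plane is left-monotone if its topological support is. -/
def IsLeftMonotone (π : Measure (ℝ × ℝ)) : Prop :=
  IsLeftMonotoneSet π.support

/-! The engine is an exchange. Suppose mass sits at `(x, a)`, `(x, b)` and `(x', z)` with `x < x'`
and `z = (1 - l) a + l b` strictly between `a` and `b`. Sending the `a`, `b` masses, weighted `1 -
l` and `l`, to `x'` and the `z` mass to `x` keeps both marginals and the barycenter of each fibre;
strict concavity of `c x' · - c x ·` makes it strictly cheaper. Integrating over forks (two
independent draws from one fibre) paired with an independent point of `π`, optimality forces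
crossings to be null: `measure_crossing_eq_zero`.

Passing to the support needs the common barycenter `m`, since fibres near `x` that charge a
neighbourhood of `z⁻` need not charge one of `z⁺`. If `z' ≤ m`, a fibre charging points below `z'`
has mean `m`, hence also charges points above `m`: the leg near `z⁻` alone yields forks around `z'`.
If `z' ≥ m`, the leg near `z⁺` does. -/

/-- The increments of a cost satisfying the martingale Spence–Mirrlees condition are strictly
concave. -/
theorem MartingaleSpenceMirrlees.strictlyConcaveAlong_sub {X Z : Set ℝ} {c : ℝ → ℝ → ℝ}
    (h : MartingaleSpenceMirrlees X Z c)
    (hdiff : ∀ z ∈ Z, DifferentiableOn ℝ (fun x => c x z) X) {x x' : ℝ} (hx : x ∈ X)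
    (hx' : x' ∈ X) (hlt : x < x') : StrictlyConcaveAlong Z (fun z => c x' z - c x z) := by
  rcases h with ⟨hX, h⟩ | h
  · intro z₀ hz₀ z₁ hz₁ hne l hl hl' hz
    -- The Jensen gap of `c t ·` has negative `t`-derivative by strict concavity of the partial
    -- derivative; comparing its values at `x` and `x'` gives the claim.
    have hsub : Icc x x' ⊆ X := hX.out hx hx'
    have hanti : StrictAntiOn
        (fun t => (1 - l) * c t z₀ + l * c t z₁ - c t ((1 - l) * z₀ + l * z₁)) (Icc x x') := by
      refine strictAntiOn_of_deriv_neg (convex_Icc x x') ?_ ?_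
      · exact ((((hdiff z₀ hz₀).continuousOn.mono hsub).const_mul _).add
          (((hdiff z₁ hz₁).continuousOn.mono hsub).const_mul _)).sub
          ((hdiff _ hz).continuousOn.mono hsub)
      · intro t ht
        rw [interior_Icc] at ht
        have hnhds : X ∈ nhds t := Filter.mem_of_superset (Icc_mem_nhds ht.1 ht.2) hsub
        have htX : t ∈ X := mem_of_mem_nhds hnhds
        have hd : ∀ z ∈ Z, HasDerivAt (fun t => c t z) (derivWithin (fun t => c t z) X t) t :=
          fun z hz => ((hdiff z hz t htX).hasDerivWithinAt).hasDerivAt hnhds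
        have := (((hd z₀ hz₀).const_mul (1 - l)).add ((hd z₁ hz₁).const_mul l)).sub (hd _ hz)
        have hderiv : deriv
            (fun t => (1 - l) * c t z₀ + l * c t z₁ - c t ((1 - l) * z₀ + l * z₁)) t = _ :=
          this.deriv
        rw [hderiv]
        have := h t htX z₀ hz₀ z₁ hz₁ hne l hl hl' hz
        simp only at this
        linarith
    have := hanti (left_mem_Icc.2 hlt.le) (right_mem_Icc.2 hlt.le) hlt
    simp only at this ⊢
    linarith
  · exact h x hx x' hx' hlt

/-! ### Couplings and the barycenter constraint in linear form -/

section Marginals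

variable {μ ν : Measure ℝ} {π : Measure (ℝ × ℝ)}

theorem ae_fst_mem_of_mem_couplings (h : π ∈ couplings μ ν) {X : Set ℝ} (hX : μ Xᶜ = 0) :
    ∀ᵐ p ∂π, p.1 ∈ X := by
  refine ae_of_ae_map measurable_fst.aemeasurable (p := fun x => x ∈ X) ?_
  rw [h.1]
  exact hX

theorem ae_snd_mem_of_mem_couplings (h : π ∈ couplings μ ν) {Z : Set ℝ} (hZ : ν Zᶜ = 0) :
    ∀ᵐ p ∂π, p.2 ∈ Z := by
  refine ae_of_ae_map measurable_snd.aemeasurable (p := fun x => x ∈ Z) ?_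
  rw [h.2]
  exact hZ

theorem isProbabilityMeasure_of_mem_couplings [IsProbabilityMeasure μ] (h : π ∈ couplings μ ν) :
    IsProbabilityMeasure π := by
  constructor
  have := measure_univ (μ := μ)
  rwa [← h.1, Measure.map_apply measurable_fst MeasurableSet.univ, preimage_univ] at this

theorem integrable_of_measurable_of_bounded {α : Type*} [MeasurableSpace α] {M : Measure α}
    [IsFiniteMeasure M] {f : α → ℝ} (hf : Measurable f) {B : ℝ} (hB : ∀ p, |f p| ≤ B) :
    Integrable f M :=
  Integrable.of_bound hf.aestronglyMeasurable B (ae_of_all _ hB)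

theorem measurable_indicator_prod_snd {s Z : Set ℝ} (hs : MeasurableSet s)
    (hZ : MeasurableSet Z) :
    Measurable ((s ×ˢ Z).indicator (fun p : ℝ × ℝ => p.2)) :=
  measurable_snd.indicator (hs.prod hZ)

/-- Truncation to `Z` gives a bound at every point, so the integrand is integrable against any
finite measure, wherever it is concentrated. -/
theorem exists_abs_indicator_prod_snd_le {Z : Set ℝ} (hZ : IsCompact Z) :
    ∃ B, ∀ (s : Set ℝ) (p : ℝ × ℝ), |(s ×ˢ Z).indicator (fun p : ℝ × ℝ => p.2) p| ≤ B := by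
  obtain ⟨B, hB⟩ := hZ.isBounded.exists_norm_le
  refine ⟨max B 0, fun s p => ?_⟩
  by_cases hp : p ∈ s ×ˢ Z
  · rw [indicator_of_mem hp]
    exact (hB _ hp.2).trans (le_max_left _ _)
  · rw [indicator_of_notMem hp]
    simp

theorem integrable_snd_of_mem_couplings [IsProbabilityMeasure μ] (h : π ∈ couplings μ ν)
    {Z : Set ℝ} (hZ : IsCompact Z) (hν : ν Zᶜ = 0) : Integrable (fun p : ℝ × ℝ => p.2) π := by
  have := isProbabilityMeasure_of_mem_couplings h
  obtain ⟨B, hB⟩ := hZ.isBounded.exists_norm_le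
  refine Integrable.of_bound measurable_snd.aestronglyMeasurable B ?_
  filter_upwards [ae_snd_mem_of_mem_couplings h hν] with p hp using hB _ hp

theorem integral_indicator_prod_snd (h : π ∈ couplings μ ν) {Z : Set ℝ} (hν : ν Zᶜ = 0)
    {s : Set ℝ} (hs : MeasurableSet s) :
    ∫ p, (s ×ˢ Z).indicator (fun p : ℝ × ℝ => p.2) p ∂π
      = ∫ p in s ×ˢ univ, p.2 ∂π := by
  rw [← integral_indicator (hs.prod MeasurableSet.univ)]
  refine integral_congr_ae ?_
  filter_upwards [ae_snd_mem_of_mem_couplings h hν] with p hp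
  by_cases hps : p.1 ∈ s
  · rw [indicator_of_mem (mk_mem_prod hps hp : p ∈ s ×ˢ Z),
      indicator_of_mem (mk_mem_prod hps (mem_univ _) : p ∈ s ×ˢ univ)]
  · rw [indicator_of_notMem (fun h' => hps h'.1), indicator_of_notMem (fun h' => hps h'.1)]

/-- For a compactly supported second marginal, prescribing a constant conditional barycenter
amounts to prescribing the integrals of the second coordinate over vertical strips. -/
theorem mem_barycenterCouplings_const_iff [IsProbabilityMeasure μ] {m : ℝ} {Z : Set ℝ}
    (hZ : IsCompact Z) (hν : ν Zᶜ = 0) :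
    π ∈ barycenterCouplings (fun _ => m) μ ν ↔ π ∈ couplings μ ν ∧
      ∀ s, MeasurableSet s →
        ∫ p, (s ×ˢ Z).indicator (fun p : ℝ × ℝ => p.2) p ∂π = μ.real s * m := by
  constructor
  · rintro ⟨hπ, κ, hκ, hπκ, hbar⟩
    refine ⟨hπ, fun s hs => ?_⟩
    have hint := integrable_snd_of_mem_couplings hπ hZ hν
    rw [integral_indicator_prod_snd hπ hν hs]
    rw [hπκ] at hint ⊢
    rw [Measure.setIntegral_compProd hs MeasurableSet.univ hint.integrableOn]
    have : ∫ x in s, ∫ z in univ, z ∂κ x ∂μ = ∫ x in s, m ∂μ := by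
      refine integral_congr_ae (ae_restrict_of_ae ?_)
      filter_upwards [hbar] with x hx
      rw [Measure.restrict_univ, hx.2]
    simpa using this
  · rintro ⟨hπ, hbar⟩
    have := isProbabilityMeasure_of_mem_couplings hπ
    have hdis : μ ⊗ₘ π.condKernel = π := by
      have := π.disintegrate π.condKernel
      rwa [show π.fst = μ from hπ.1] at this
    have hint := integrable_snd_of_mem_couplings hπ hZ hν
    have hint' : Integrable (fun p : ℝ × ℝ => p.2) (μ ⊗ₘ π.condKernel) := by rwa [hdis]
    refine ⟨hπ, π.condKernel, inferInstance, hdis.symm, ?_⟩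
    have h1 := ((Measure.integrable_compProd_iff hint'.aestronglyMeasurable).1 hint').1
    have hcond : Integrable (fun x => ∫ z, z ∂(π.condKernel x)) μ := by
      have := hint.integral_condKernel
      rwa [show π.fst = μ from hπ.1] at this
    have h2 : (fun x => ∫ z, z ∂(π.condKernel x)) =ᵐ[μ] fun _ => m := by
      refine Integrable.ae_eq_of_forall_setIntegral_eq _ _ hcond
        (integrable_const m) fun s hs _ => ?_
      have := hbar s hs
      rw [integral_indicator_prod_snd hπ hν hs, ← hdis,
        Measure.setIntegral_compProd hs MeasurableSet.univ hint'.integrableOn] at this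
      simpa using this
    filter_upwards [h1, h2] with x hx hx' using ⟨hx, hx'⟩

end Marginals

/-! ### Randomized choice between two maps -/

section Mixture

variable {Ω E F : Type*} [MeasurableSpace Ω] [MeasurableSpace E] [MeasurableSpace F]

/-- The law obtained from `M` by taking `u` with weight `1 - l` and `v` with weight `l`. -/
noncomputable def mixtureMap (M : Measure Ω) (l : Ω → ℝ) (u v : Ω → E) : Measure E :=
  (M.withDensity fun w => ENNReal.ofReal (1 - l w)).map u +
    (M.withDensity fun w => ENNReal.ofReal (l w)).map v

variable {M : Measure Ω} {l : Ω → ℝ} {u v : Ω → E}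

theorem withDensity_ofReal_le {f : Ω → ℝ} (hf : ∀ᵐ w ∂M, f w ≤ 1) :
    M.withDensity (fun w => ENNReal.ofReal (f w)) ≤ M := by
  conv_rhs => rw [← withDensity_one (μ := M)]
  refine withDensity_mono ?_
  filter_upwards [hf] with w hw
  simpa using hw

/-- Each weight is at most 1. The bound is crude, but the exchanged mass can be scaled down to
absorb the loss. -/
theorem mixtureMap_le (hl : ∀ᵐ w ∂M, l w ∈ Icc (0 : ℝ) 1) (hu : Measurable u)
    (hv : Measurable v) : mixtureMap M l u v ≤ M.map u + M.map v := by
  refine add_le_add (Measure.map_mono (withDensity_ofReal_le ?_) hu)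
    (Measure.map_mono (withDensity_ofReal_le ?_) hv)
  · filter_upwards [hl] with w hw
    linarith [hw.1]
  · filter_upwards [hl] with w hw using hw.2

theorem mixtureMap_map {g : E → F} (hg : Measurable g) (hu : Measurable u) (hv : Measurable v) :
    (mixtureMap M l u v).map g = mixtureMap M l (g ∘ u) (g ∘ v) := by
  rw [mixtureMap, Measure.map_add _ _ hg, Measure.map_map hg hu, Measure.map_map hg hv, mixtureMap]

theorem mixtureMap_self (hlm : Measurable l) (hl : ∀ᵐ w ∂M, l w ∈ Icc (0 : ℝ) 1)
    (hu : Measurable u) : mixtureMap M l u u = M.map u := by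
  rw [mixtureMap, ← Measure.map_add _ _ hu, ← withDensity_add_left (by fun_prop)]
  congr 1
  conv_rhs => rw [← withDensity_one (μ := M)]
  refine withDensity_congr_ae ?_
  filter_upwards [hl] with w hw
  rw [Pi.add_apply, ← ENNReal.ofReal_add (by linarith [hw.2]) hw.1]
  simp

theorem isFiniteMeasure_mixtureMap [IsFiniteMeasure M] (hl : ∀ᵐ w ∂M, l w ∈ Icc (0 : ℝ) 1)
    (hu : Measurable u) (hv : Measurable v) : IsFiniteMeasure (mixtureMap M l u v) :=
  isFiniteMeasure_of_le _ (mixtureMap_le hl hu hv)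

theorem integral_mixtureMap [IsFiniteMeasure M] (hlm : Measurable l)
    (hl : ∀ᵐ w ∂M, l w ∈ Icc (0 : ℝ) 1) (hu : Measurable u) (hv : Measurable v)
    {f : E → ℝ} (hf : Measurable f) {B : ℝ} (hB : ∀ p, |f p| ≤ B) :
    ∫ p, f p ∂(mixtureMap M l u v) = ∫ w, ((1 - l w) * f (u w) + l w * f (v w)) ∂M := by
  have h1 : IsFiniteMeasure (M.withDensity fun w => ENNReal.ofReal (1 - l w)) :=
    isFiniteMeasure_of_le M
      (withDensity_ofReal_le (by filter_upwards [hl] with w hw using by linarith [hw.1]))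
  have h2 : IsFiniteMeasure (M.withDensity fun w => ENNReal.ofReal (l w)) :=
    isFiniteMeasure_of_le M
      (withDensity_ofReal_le (by filter_upwards [hl] with w hw using hw.2))
  rw [mixtureMap, integral_add_measure (integrable_of_measurable_of_bounded hf hB)
    (integrable_of_measurable_of_bounded hf hB), integral_map hu.aemeasurable
    hf.aestronglyMeasurable, integral_map hv.aemeasurable hf.aestronglyMeasurable,
    integral_withDensity_eq_integral_toReal_smul (by fun_prop) (by simp),
    integral_withDensity_eq_integral_toReal_smul (by fun_prop) (by simp), ← integral_add]
  · refine integral_congr_ae ?_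
    filter_upwards [hl] with w hw
    rw [ENNReal.toReal_ofReal (by linarith [hw.2]), ENNReal.toReal_ofReal hw.1, smul_eq_mul,
      smul_eq_mul]
  all_goals
    refine (integrable_of_measurable_of_bounded (f := fun w => f _) (by fun_prop)
      fun p => hB _).bdd_mul (c := 1)
      (Measurable.aestronglyMeasurable (by fun_prop)) ?_
    filter_upwards [hl] with w hw
    rw [Real.norm_of_nonneg ENNReal.toReal_nonneg]
    refine ENNReal.toReal_le_of_le_ofReal zero_le_one (ENNReal.ofReal_le_ofReal ?_)
    linarith [hw.1, hw.2]

end Mixture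

/-! ### Exchange competitors and nullity of crossings -/

section Exchange

variable {Ω : Type*} [MeasurableSpace Ω] {M : Measure Ω} [IsFiniteMeasure M]

theorem integrable_weighted {E : Type*} [MeasurableSpace E] {l : Ω → ℝ} {u v : Ω → E}
    (hlm : Measurable l) (hl : ∀ᵐ w ∂M, l w ∈ Icc (0 : ℝ) 1) (hu : Measurable u)
    (hv : Measurable v) {f : E → ℝ} (hf : Measurable f) {B : ℝ} (hB : ∀ p, |f p| ≤ B) :
    Integrable (fun w => (1 - l w) * f (u w) + l w * f (v w)) M := by
  refine Integrable.of_bound (Measurable.aestronglyMeasurable (by fun_prop)) B ?_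
  filter_upwards [hl] with w hw
  have h1 := abs_le.1 (hB (u w))
  have h2 := abs_le.1 (hB (v w))
  have h3 : (0 : ℝ) ≤ 1 - l w := by linarith [hw.2]
  rw [Real.norm_eq_abs, abs_le]
  constructor
  · nlinarith [mul_le_mul_of_nonneg_left h1.1 h3, mul_le_mul_of_nonneg_left h2.1 hw.1]
  · nlinarith [mul_le_mul_of_nonneg_left h1.2 h3, mul_le_mul_of_nonneg_left h2.2 hw.1]

/-- Moving mass along a measure `M` of elementary exchanges that preserve both marginals and the
conditional barycenters yields a competitor; optimality says that it is not cheaper. -/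
theorem IsFixedBarycenterOptimal.integral_le_of_exchange {σX σZ : Measure ℝ}
    [IsProbabilityMeasure σX] {Z : Set ℝ} (hZ : IsCompact Z)
    (hσZ : σZ Zᶜ = 0) {c : ℝ → ℝ → ℝ} {π : Measure (ℝ × ℝ)}
    (hπ : IsFixedBarycenterOptimal c σX σZ π)
    {C : ℝ × ℝ → ℝ} (hC : Measurable C) {B : ℝ} (hB : ∀ p, |C p| ≤ B)
    (hcC : ∀ π' ∈ couplings σX σZ, ∫ p, c p.1 p.2 ∂π' = ∫ p, C p ∂π')
    {x₁ x₂ a b z l : Ω → ℝ} (hx₁ : Measurable x₁) (hx₂ : Measurable x₂) (ha : Measurable a)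
    (hb : Measurable b) (hz : Measurable z) (hlm : Measurable l)
    (hl : ∀ᵐ w ∂M, l w ∈ Icc (0 : ℝ) 1)
    (hmix : ∀ᵐ w ∂M, (1 - l w) * a w + l w * b w = z w)
    (hmem : ∀ᵐ w ∂M, a w ∈ Z ∧ b w ∈ Z ∧ z w ∈ Z)
    {ρ : Measure (ℝ × ℝ)} (hρ : ρ + ρ + ρ = π)
    (ha_le : M.map (fun w => (x₁ w, a w)) ≤ ρ) (hb_le : M.map (fun w => (x₁ w, b w)) ≤ ρ)
    (hz_le : M.map (fun w => (x₂ w, z w)) ≤ ρ) :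
    ∫ w, (((1 - l w) * C (x₁ w, a w) + l w * C (x₁ w, b w)) + C (x₂ w, z w)) ∂M ≤
      ∫ w, (((1 - l w) * C (x₂ w, a w) + l w * C (x₂ w, b w)) + C (x₁ w, z w)) ∂M := by
  obtain ⟨hπ, hopt⟩ := hπ
  obtain ⟨hcpl, hstrip⟩ := (mem_barycenterCouplings_const_iff hZ hσZ).1 hπ
  have hprob := isProbabilityMeasure_of_mem_couplings hcpl
  have hx₁a : Measurable (fun w => (x₁ w, a w)) := hx₁.prodMk ha
  have hx₁b : Measurable (fun w => (x₁ w, b w)) := hx₁.prodMk hb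
  have hx₁z : Measurable (fun w => (x₁ w, z w)) := hx₁.prodMk hz
  have hx₂a : Measurable (fun w => (x₂ w, a w)) := hx₂.prodMk ha
  have hx₂b : Measurable (fun w => (x₂ w, b w)) := hx₂.prodMk hb
  have hx₂z : Measurable (fun w => (x₂ w, z w)) := hx₂.prodMk hz
  have hfin₁ := isFiniteMeasure_mixtureMap hl hx₁a hx₁b
  have hfin₂ := isFiniteMeasure_mixtureMap hl hx₂a hx₂b
  -- `N` is the mass removed and `A` the mass put back.
  set N := mixtureMap M l (fun w => (x₁ w, a w)) (fun w => (x₁ w, b w)) +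
    M.map (fun w => (x₂ w, z w)) with hN
  set A := mixtureMap M l (fun w => (x₂ w, a w)) (fun w => (x₂ w, b w)) +
    M.map (fun w => (x₁ w, z w)) with hA
  have hNle : N ≤ π := by
    rw [← hρ]
    exact add_le_add ((mixtureMap_le hl hx₁a hx₁b).trans (add_le_add ha_le hb_le)) hz_le
  have hintN : ∀ {f : ℝ × ℝ → ℝ} {B : ℝ}, Measurable f → (∀ p, |f p| ≤ B) → (∫ p, f p ∂N) =
      ∫ w, (((1 - l w) * f (x₁ w, a w) + l w * f (x₁ w, b w)) + f (x₂ w, z w)) ∂M := by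
    intro f B hf hB
    rw [hN, integral_add_measure (integrable_of_measurable_of_bounded hf hB)
      (integrable_of_measurable_of_bounded hf hB), integral_mixtureMap hlm hl hx₁a hx₁b hf hB,
      integral_map hx₂z.aemeasurable hf.aestronglyMeasurable, ← integral_add]
    · exact integrable_weighted hlm hl hx₁a hx₁b hf hB
    · exact integrable_of_measurable_of_bounded (hf.comp hx₂z) fun w => hB _
  have hintA : ∀ {f : ℝ × ℝ → ℝ} {B : ℝ}, Measurable f → (∀ p, |f p| ≤ B) → (∫ p, f p ∂A) =
      ∫ w, (((1 - l w) * f (x₂ w, a w) + l w * f (x₂ w, b w)) + f (x₁ w, z w)) ∂M := by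
    intro f B hf hB
    rw [hA, integral_add_measure (integrable_of_measurable_of_bounded hf hB)
      (integrable_of_measurable_of_bounded hf hB), integral_mixtureMap hlm hl hx₂a hx₂b hf hB,
      integral_map hx₁z.aemeasurable hf.aestronglyMeasurable, ← integral_add]
    · exact integrable_weighted hlm hl hx₂a hx₂b hf hB
    · exact integrable_of_measurable_of_bounded (hf.comp hx₁z) fun w => hB _
  have hfst : N.map Prod.fst = A.map Prod.fst := by
    rw [hN, hA, Measure.map_add _ _ measurable_fst, Measure.map_add _ _ measurable_fst,
      mixtureMap_map measurable_fst hx₁a hx₁b, mixtureMap_map measurable_fst hx₂a hx₂b,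
      Measure.map_map measurable_fst hx₂z, Measure.map_map measurable_fst hx₁z]
    change mixtureMap M l x₁ x₁ + M.map x₂ = mixtureMap M l x₂ x₂ + M.map x₁
    rw [mixtureMap_self hlm hl hx₁, mixtureMap_self hlm hl hx₂, add_comm]
  have hsnd : N.map Prod.snd = A.map Prod.snd := by
    rw [hN, hA, Measure.map_add _ _ measurable_snd, Measure.map_add _ _ measurable_snd,
      mixtureMap_map measurable_snd hx₁a hx₁b, mixtureMap_map measurable_snd hx₂a hx₂b,
      Measure.map_map measurable_snd hx₂z, Measure.map_map measurable_snd hx₁z]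
    rfl
  set π' := π - N + A with hπ'
  -- `N ≤ π` makes the subtraction genuine; afterwards only this identity of finite measures is
  -- used, by cancelling `N`.
  have hbal : π' + N = π + A := by
    rw [hπ', add_right_comm, Measure.sub_add_cancel_of_le hNle]
  have hint : ∀ {f : ℝ × ℝ → ℝ} {B : ℝ}, Measurable f → (∀ p, |f p| ≤ B) →
      (∫ p, f p ∂π') + (∫ p, f p ∂N) = (∫ p, f p ∂π) + (∫ p, f p ∂A) := by
    intro f B hf hB
    rw [← integral_add_measure (integrable_of_measurable_of_bounded hf hB)
      (integrable_of_measurable_of_bounded hf hB), hbal,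
      integral_add_measure (integrable_of_measurable_of_bounded hf hB)
      (integrable_of_measurable_of_bounded hf hB)]
  have hcpl' : π' ∈ couplings σX σZ := by
    constructor
    · rw [← Measure.add_left_inj (N.map Prod.fst), ← Measure.map_add _ _ measurable_fst, hbal,
        Measure.map_add _ _ measurable_fst, hcpl.1, hfst]
    · rw [← Measure.add_left_inj (N.map Prod.snd), ← Measure.map_add _ _ measurable_snd, hbal,
        Measure.map_add _ _ measurable_snd, hcpl.2, hsnd]
  have hmem' : π' ∈ barycenterCouplings (fun _ => ∫ z, z ∂σZ) σX σZ := by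
    refine (mem_barycenterCouplings_const_iff hZ hσZ).2 ⟨hcpl', fun s hs => ?_⟩
    obtain ⟨B', hB'⟩ := exists_abs_indicator_prod_snd_le hZ
    have hm := measurable_indicator_prod_snd hs hZ.measurableSet
    have h := hint hm (hB' s)
    rw [hstrip s hs, hintN hm (hB' s), hintA hm (hB' s)] at h
    refine add_right_cancel (h.trans ?_)
    congr 1
    -- Since `(1 - l) a + l b = z`, both integrands equal `z` times the sum of the indicators of `s`
    -- at `x₁` and `x₂`.
    refine integral_congr_ae ?_
    filter_upwards [hmix, hmem] with w hw ⟨hwa, hwb, hwz⟩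
    have key : ∀ x y : ℝ, y ∈ Z → (s ×ˢ Z).indicator (fun p : ℝ × ℝ => p.2) (x, y) =
        s.indicator (fun _ => (1 : ℝ)) x * y := by
      intro x y hy
      by_cases hx : x ∈ s <;> simp [hx, hy]
    rw [key _ _ hwa, key _ _ hwb, key _ _ hwz, key _ _ hwa, key _ _ hwb, key _ _ hwz, ← hw]
    ring
  have hle := hopt π' hmem'
  rw [hcC π hcpl, hcC π' hcpl'] at hle
  have h := hint hC hB
  rw [hintN hC hB, hintA hC hB] at h
  linarith

end Exchange

/-- Almost no pair of a fork over `x₁` and a point over `x₂ > x₁` under an optimal coupling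
exhibits a crossing. -/
theorem IsFixedBarycenterOptimal.measure_crossing_eq_zero {X Z : Set ℝ} (hX : IsCompact X)
    (hZ : IsCompact Z) {σX σZ : Measure ℝ} [IsProbabilityMeasure σX]
    (hσX : σX Xᶜ = 0) (hσZ : σZ Zᶜ = 0) {c : ℝ → ℝ → ℝ}
    (hcont : ContinuousOn (fun p : ℝ × ℝ => c p.1 p.2) (X ×ˢ Z))
    (hinc : ∀ x ∈ X, ∀ x' ∈ X, x < x' → StrictlyConcaveAlong Z (fun z => c x' z - c x z))
    {π : Measure (ℝ × ℝ)} (hπ : IsFixedBarycenterOptimal c σX σZ π)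
    {τ : Measure (ℝ × ℝ × ℝ)} [IsProbabilityMeasure τ]
    (hτ₁ : τ.map (fun p => (p.1, p.2.1)) = π) (hτ₂ : τ.map (fun p => (p.1, p.2.2)) = π) :
    (τ.prod π) {w | w.1.1 < w.2.1 ∧ w.1.2.1 < w.2.2 ∧ w.2.2 < w.1.2.2} = 0 := by
  have hcpl := hπ.1.1
  have hprob := isProbabilityMeasure_of_mem_couplings hcpl
  set W : Set ((ℝ × ℝ × ℝ) × ℝ × ℝ) := {w | w.1.1 < w.2.1 ∧ w.1.2.1 < w.2.2 ∧ w.2.2 < w.1.2.2}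
    with hW
  have hWm : MeasurableSet W := by
    have h1 : MeasurableSet {w : (ℝ × ℝ × ℝ) × ℝ × ℝ | w.1.1 < w.2.1} :=
      measurableSet_lt (by fun_prop) (by fun_prop)
    have h2 : MeasurableSet {w : (ℝ × ℝ × ℝ) × ℝ × ℝ | w.1.2.1 < w.2.2} :=
      measurableSet_lt (by fun_prop) (by fun_prop)
    have h3 : MeasurableSet {w : (ℝ × ℝ × ℝ) × ℝ × ℝ | w.2.2 < w.1.2.2} :=
      measurableSet_lt (by fun_prop) (by fun_prop)
    exact h1.inter (h2.inter h3)
  set C : ℝ × ℝ → ℝ := (X ×ˢ Z).indicator (fun p => c p.1 p.2) with hCdef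
  have hC : Measurable C := by
    classical
    rw [hCdef, ← piecewise_eq_indicator]
    exact hcont.measurable_piecewise continuousOn_const (hX.prod hZ).measurableSet
  obtain ⟨B, hB⟩ : ∃ B, ∀ p, |C p| ≤ B := by
    obtain ⟨B, hB⟩ := (hX.prod hZ).exists_bound_of_continuousOn hcont
    refine ⟨max B 0, fun p => ?_⟩
    by_cases hp : p ∈ X ×ˢ Z
    · rw [hCdef, indicator_of_mem hp]
      exact (hB p hp).trans (le_max_left _ _)
    · rw [hCdef, indicator_of_notMem hp]
      simp
  have hcC : ∀ π' ∈ couplings σX σZ, ∫ p, c p.1 p.2 ∂π' = ∫ p, C p ∂π' := by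
    intro π' hπ'
    refine integral_congr_ae ?_
    filter_upwards [ae_fst_mem_of_mem_couplings hπ' hσX, ae_snd_mem_of_mem_couplings hπ' hσZ]
      with p hp hp'
    rw [hCdef, indicator_of_mem (mk_mem_prod hp hp' : p ∈ X ×ˢ Z)]
  -- Three projections of `M` are removed from `π`, so each gets a third of it.
  set M : Measure ((ℝ × ℝ × ℝ) × ℝ × ℝ) := (3⁻¹ : ENNReal) • (τ.prod π).restrict W with hM
  have hMfin : IsFiniteMeasure M := Measure.smul_finite _ (by simp)
  have hMle : M ≤ (3⁻¹ : ENNReal) • τ.prod π := by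
    rw [hM]
    gcongr
    exact Measure.restrict_le_self
  have hmap : ∀ {g : (ℝ × ℝ × ℝ) × ℝ × ℝ → ℝ × ℝ}, Measurable g → (τ.prod π).map g = π →
      M.map g ≤ (3⁻¹ : ENNReal) • π := by
    intro g hg h
    refine (Measure.map_mono hMle hg).trans_eq ?_
    rw [Measure.map_smul, h]
  have hproj₁ : (τ.prod π).map (fun w => (w.1.1, w.1.2.1)) = π := by
    conv_rhs => rw [← hτ₁, ← Measure.fst_prod (μ := τ) (ν := π), Measure.fst]
    rw [Measure.map_map (by fun_prop) (by fun_prop)]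
    rfl
  have hproj₂ : (τ.prod π).map (fun w => (w.1.1, w.1.2.2)) = π := by
    conv_rhs => rw [← hτ₂, ← Measure.fst_prod (μ := τ) (ν := π), Measure.fst]
    rw [Measure.map_map (by fun_prop) (by fun_prop)]
    rfl
  have hproj₃ : (τ.prod π).map (fun w => (w.2.1, w.2.2)) = π := by
    exact Measure.snd_prod
  have hac : ∀ {g : (ℝ × ℝ × ℝ) × ℝ × ℝ → ℝ × ℝ}, Measurable g → (τ.prod π).map g = π →
      ∀ᵐ w ∂M, g w ∈ X ×ˢ Z := by
    intro g hg h
    have h1 : ∀ᵐ p ∂((τ.prod π).map g), p ∈ X ×ˢ Z := by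
      rw [h]
      filter_upwards [ae_fst_mem_of_mem_couplings hcpl hσX, ae_snd_mem_of_mem_couplings hcpl hσZ]
        with p hp hp' using ⟨hp, hp'⟩
    exact Measure.ae_smul_measure (ae_restrict_of_ae (ae_of_ae_map hg.aemeasurable h1)) _
  have hMW : ∀ᵐ w ∂M, w ∈ W := Measure.ae_smul_measure (ae_restrict_mem hWm) _
  have hm₁ := hac (by fun_prop) hproj₁
  have hm₂ := hac (by fun_prop) hproj₂
  have hm₃ := hac (by fun_prop) hproj₃
  set l : (ℝ × ℝ × ℝ) × ℝ × ℝ → ℝ := fun w => (w.2.2 - w.1.2.1) / (w.1.2.2 - w.1.2.1) with hldef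
  have hlm : Measurable l := by fun_prop
  have hl : ∀ w ∈ W, 0 < l w ∧ l w < 1 := by
    rintro w ⟨-, h1, h2⟩
    have h3 : 0 < w.1.2.2 - w.1.2.1 := by linarith
    exact ⟨div_pos (by linarith) h3, (div_lt_one h3).2 (by linarith)⟩
  have hmix : ∀ w ∈ W, (1 - l w) * w.1.2.1 + l w * w.1.2.2 = w.2.2 := by
    rintro w ⟨-, h1, h2⟩
    have h3 : w.1.2.2 - w.1.2.1 ≠ 0 := by linarith
    simp only [hldef]
    field_simp
    ring
  have hl' : ∀ᵐ w ∂M, l w ∈ Icc (0 : ℝ) 1 := by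
    filter_upwards [hMW] with w hw using ⟨(hl w hw).1.le, (hl w hw).2.le⟩
  have hρ : (3⁻¹ : ENNReal) • π + (3⁻¹ : ENNReal) • π + (3⁻¹ : ENNReal) • π = π := by
    rw [← add_smul, ← add_smul, ENNReal.inv_three_add_inv_three, one_smul]
  have hle := hπ.integral_le_of_exchange (M := M) hZ hσZ hC hB hcC (x₁ := fun w => w.1.1)
    (x₂ := fun w => w.2.1) (a := fun w => w.1.2.1) (b := fun w => w.1.2.2) (z := fun w => w.2.2)
    (by fun_prop) (by fun_prop) (by fun_prop) (by fun_prop) (by fun_prop) hlm hl'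
    (by filter_upwards [hMW] with w hw using hmix w hw)
    (by filter_upwards [hm₁, hm₂, hm₃] with w h1 h2 h3 using ⟨h1.2, h2.2, h3.2⟩)
    hρ (hmap (by fun_prop) hproj₁) (hmap (by fun_prop) hproj₂) (hmap (by fun_prop) hproj₃)
  have hlt : ∀ᵐ w ∂M, ((1 - l w) * C (w.2.1, w.1.2.1) + l w * C (w.2.1, w.1.2.2)) +
      C (w.1.1, w.2.2) < ((1 - l w) * C (w.1.1, w.1.2.1) + l w * C (w.1.1, w.1.2.2)) +
      C (w.2.1, w.2.2) := by
    filter_upwards [hMW, hm₁, hm₂, hm₃] with w hw ⟨h1, h1'⟩ ⟨_, h2'⟩ ⟨h3, h3'⟩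
    have hval : ∀ x ∈ X, ∀ z ∈ Z, C (x, z) = c x z := fun x hx z hz =>
      indicator_of_mem (mk_mem_prod hx hz) _
    have hz := hmix w hw
    have h := hinc _ h1 _ h3 hw.1 _ h1' _ h2' (hw.2.1.trans hw.2.2).ne (l w) (hl w hw).1
      (hl w hw).2 (by rw [hz]; exact h3')
    simp only [hz] at h
    rw [hval _ h3 _ h1', hval _ h3 _ h2', hval _ h1 _ h3', hval _ h1 _ h1', hval _ h1 _ h2',
      hval _ h3 _ h3']
    linarith
  have hi₁ := (integrable_weighted (M := M) (u := fun w => (w.1.1, w.1.2.1))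
    (v := fun w => (w.1.1, w.1.2.2)) hlm hl' (by fun_prop) (by fun_prop) hC hB).add
    (integrable_of_measurable_of_bounded (f := fun w => C (w.2.1, w.2.2)) (by fun_prop)
      fun w => hB _)
  have hi₂ := (integrable_weighted (M := M) (u := fun w => (w.2.1, w.1.2.1))
    (v := fun w => (w.2.1, w.1.2.2)) hlm hl' (by fun_prop) (by fun_prop) hC hB).add
    (integrable_of_measurable_of_bounded (f := fun w => C (w.1.1, w.2.2)) (by fun_prop)
      fun w => hB _)
  -- Optimality turns the pointwise strict inequality into equality of integrals, which is possible
  -- only if `M = 0`.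
  have heq := (integral_eq_iff_of_ae_le hi₂ hi₁ (hlt.mono fun w hw => hw.le)).1
    (le_antisymm (integral_mono_ae hi₂ hi₁ (hlt.mono fun w hw => hw.le)) hle)
  have hfalse : ∀ᵐ w ∂M, False := by
    filter_upwards [hlt, heq] with w h1 h2 using h1.ne h2
  have hM0 : M univ = 0 := by
    rw [ae_iff] at hfalse
    simpa using hfalse
  simpa [hM] using hM0

/-! ### From null crossings to the support -/

theorem measure_Iio_eq_zero_of_measure_Ioi_eq_zero {ν : Measure ℝ} [IsProbabilityMeasure ν]
    {m : ℝ} (hν : Integrable (fun z => z) ν) (hm : ∫ z, z ∂ν = m) (h : ν (Ioi m) = 0) :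
    ν (Iio m) = 0 := by
  have hle : (fun z => z) ≤ᵐ[ν] fun _ => m := by
    refine measure_mono_null (fun z hz => ?_) h
    simpa using hz
  have heq := (integral_eq_iff_of_ae_le hν (integrable_const m) hle).1 (by simpa using hm)
  refine measure_mono_null (fun z hz => ?_) heq
  exact (ne_of_lt hz : z ≠ m)

theorem measure_Ioi_eq_zero_of_measure_Iio_eq_zero {ν : Measure ℝ} [IsProbabilityMeasure ν]
    {m : ℝ} (hν : Integrable (fun z => z) ν) (hm : ∫ z, z ∂ν = m) (h : ν (Iio m) = 0) :
    ν (Ioi m) = 0 := by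
  have hle : (fun _ => m) ≤ᵐ[ν] fun z => z := by
    refine measure_mono_null (fun z hz => ?_) h
    simpa using hz
  have heq := (integral_eq_iff_of_ae_le (integrable_const m) hν hle).1 (by simpa using hm.symm)
  refine measure_mono_null (fun z hz => ?_) heq
  exact (ne_of_lt hz : m ≠ z)

section Fork

variable {μ : Measure ℝ} [IsProbabilityMeasure μ] {κ : Kernel ℝ ℝ} [IsMarkovKernel κ]

theorem compProd_prod_map_left :
    (μ ⊗ₘ (κ ×ₖ κ)).map (fun p => (p.1, p.2.1)) = μ ⊗ₘ κ := by
  have h := Measure.compProd_map (μ := μ) (κ := κ ×ₖ κ) measurable_fst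
  rw [← Kernel.fst_eq, Kernel.fst_prod] at h
  exact h.symm

theorem compProd_prod_map_right :
    (μ ⊗ₘ (κ ×ₖ κ)).map (fun p => (p.1, p.2.2)) = μ ⊗ₘ κ := by
  have h := Measure.compProd_map (μ := μ) (κ := κ ×ₖ κ) measurable_snd
  rw [← Kernel.snd_eq, Kernel.snd_prod] at h
  exact h.symm

/-- The two legs are independent given `x`, so the fibre mass of `I ×ˢ J` is a product. -/
theorem ae_eq_zero_or_of_compProd_prod_eq_zero {S I J : Set ℝ} (hS : MeasurableSet S)
    (hI : MeasurableSet I) (hJ : MeasurableSet J) (h : (μ ⊗ₘ (κ ×ₖ κ)) (S ×ˢ I ×ˢ J) = 0) :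
    ∀ᵐ x ∂μ.restrict S, κ x I = 0 ∨ κ x J = 0 := by
  rw [Measure.compProd_apply_prod hS (hI.prod hJ), lintegral_eq_zero_iff (Kernel.measurable_coe _ (hI.prod hJ))] at h
  filter_upwards [h] with x hx
  rw [Kernel.prod_apply_prod] at hx
  exact mul_eq_zero.1 hx

theorem compProd_prod_eq_zero {S I : Set ℝ} (hS : MeasurableSet S) (hI : MeasurableSet I)
    (h : ∀ᵐ x ∂μ.restrict S, κ x I = 0) : (μ ⊗ₘ κ) (S ×ˢ I) = 0 := by
  rw [Measure.compProd_apply_prod hS hI, lintegral_congr_ae h]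
  simp

end Fork

theorem measure_ne_zero_of_mem_support {π : Measure (ℝ × ℝ)} {x z : ℝ} (h : (x, z) ∈ π.support)
    {S I : Set ℝ} (hS : IsOpen S) (hI : IsOpen I) (hx : x ∈ S) (hz : z ∈ I) : π (S ×ˢ I) ≠ 0 :=
  ((Measure.mem_support_iff_forall _).1 h _ ((hS.prod hI).mem_nhds ⟨hx, hz⟩)).ne'

/-- Continuity from below along `m + 1 / (n + 1)`. It covers the borderline case `z' = m`, where
crossings are excluded only for thresholds strictly beyond `z'`. -/
theorem exists_gt_measure_ne_zero {τ : Measure (ℝ × ℝ × ℝ)} {S I : Set ℝ} {m : ℝ}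
    (h : τ (S ×ˢ I ×ˢ Ioi m) ≠ 0) : ∃ β > m, τ (S ×ˢ I ×ˢ Ioi β) ≠ 0 := by
  by_contra! hcon
  refine h (measure_mono_null ?_ (measure_iUnion_null fun n : ℕ =>
    hcon (m + 1 / ((n : ℝ) + 1)) (lt_add_of_pos_right _ Nat.one_div_pos_of_nat)))
  rintro p ⟨h1, h2, h3⟩
  obtain ⟨n, hn⟩ := exists_nat_one_div_lt (sub_pos.2 (show m < p.2.2 from h3))
  exact mem_iUnion.2 ⟨n, h1, h2, show m + 1 / ((n : ℝ) + 1) < p.2.2 by linarith⟩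

theorem exists_lt_measure_ne_zero {τ : Measure (ℝ × ℝ × ℝ)} {S I : Set ℝ} {m : ℝ}
    (h : τ (S ×ˢ Iio m ×ˢ I) ≠ 0) : ∃ β < m, τ (S ×ˢ Iio β ×ˢ I) ≠ 0 := by
  by_contra! hcon
  refine h (measure_mono_null ?_ (measure_iUnion_null fun n : ℕ =>
    hcon (m - 1 / ((n : ℝ) + 1)) (sub_lt_self _ Nat.one_div_pos_of_nat)))
  rintro p ⟨h1, h2, h3⟩
  obtain ⟨n, hn⟩ := exists_nat_one_div_lt (sub_pos.2 (show p.2.1 < m from h2))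
  exact mem_iUnion.2 ⟨n, h1, show p.2.1 < m - 1 / ((n : ℝ) + 1) by linarith, h3⟩

theorem mainTheorem2
    (X Z : Set ℝ) (hX : IsCompact X) (hZ : IsCompact Z)
    (σX σZ : Measure ℝ) [IsProbabilityMeasure σX] [IsProbabilityMeasure σZ]
    (hσX : σX Xᶜ = 0) (hσZ : σZ Zᶜ = 0)
    (c : ℝ → ℝ → ℝ)
    (hcont : ContinuousOn (fun p : ℝ × ℝ => c p.1 p.2) (X ×ˢ Z))
    (hdiff : ∀ z ∈ Z, DifferentiableOn ℝ (fun x => c x z) X)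
    (hSM : MartingaleSpenceMirrlees X Z c)
    (π : Measure (ℝ × ℝ)) (hπ : IsFixedBarycenterOptimal c σX σZ π) :
    IsLeftMonotone π := by
  rintro x zm zp x' z' hm hp h' - hxx' ⟨hmz, hzp⟩
  have hprob := isProbabilityMeasure_of_mem_couplings hπ.1.1
  obtain ⟨κ, hκ, hπκ, hbar⟩ := hπ.1.2
  set m := ∫ z, z ∂σZ
  set τ := σX ⊗ₘ (κ ×ₖ κ)
  have hnull := hπ.measure_crossing_eq_zero hX hZ hσX hσZ hcont
    (fun x hx x' hx' hlt => hSM.strictlyConcaveAlong_sub hdiff hx hx' hlt) (τ := τ)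
    (by rw [hπκ]; exact compProd_prod_map_left) (by rw [hπκ]; exact compProd_prod_map_right)
  obtain ⟨s, hxs, hsx'⟩ := exists_between hxx'
  have hcross : ∀ α β : ℝ, α < z' → z' < β → τ (Iio s ×ˢ Iio α ×ˢ Ioi β) = 0 := by
    intro α β hα hβ
    have hprod : (τ.prod π) ((Iio s ×ˢ Iio α ×ˢ Ioi β) ×ˢ (Ioi s ×ˢ Ioo α β)) = 0 := by
      refine measure_mono_null ?_ hnull
      rintro w ⟨⟨h1, h2, h3⟩, h4, h5⟩
      exact ⟨lt_trans h1 h4, lt_trans h2 h5.1, lt_trans h5.2 h3⟩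
    rw [Measure.prod_prod] at hprod
    -- The second factor is positive because `(x', z')` lies in the support.
    exact (mul_eq_zero.1 hprod).resolve_right
      (measure_ne_zero_of_mem_support h' isOpen_Ioi isOpen_Ioo hsx' ⟨hα, hβ⟩)
  rcases le_total z' m with hzm | hzm
  · obtain ⟨α, hmα, hαz⟩ := exists_between hmz
    have hτ : τ (Iio s ×ˢ Iio α ×ˢ Ioi m) = 0 := by
      by_contra hne
      obtain ⟨β, hβ, hne⟩ := exists_gt_measure_ne_zero hne
      exact hne (hcross α β hαz (hzm.trans_lt hβ))
    refine measure_ne_zero_of_mem_support hm isOpen_Iio isOpen_Iio hxs hmα ?_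
    rw [hπκ]
    refine compProd_prod_eq_zero measurableSet_Iio measurableSet_Iio ?_
    filter_upwards [ae_eq_zero_or_of_compProd_prod_eq_zero measurableSet_Iio measurableSet_Iio
      measurableSet_Ioi hτ, ae_restrict_of_ae hbar] with y hy ⟨hint, hmean⟩
    -- A fibre with mean `m` and no mass above `m` has none below `m` either, hence none below `α`.
    refine hy.elim id fun h0 => measure_mono_null (Iio_subset_Iio (hαz.le.trans hzm)) ?_
    exact measure_Iio_eq_zero_of_measure_Ioi_eq_zero hint hmean h0
  · obtain ⟨β, hβz, hβp⟩ := exists_between hzp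
    have hτ : τ (Iio s ×ˢ Iio m ×ˢ Ioi β) = 0 := by
      by_contra hne
      obtain ⟨α, hα, hne⟩ := exists_lt_measure_ne_zero hne
      exact hne (hcross α β (hα.trans_le hzm) hβz)
    refine measure_ne_zero_of_mem_support hp isOpen_Iio isOpen_Ioi hxs hβp ?_
    rw [hπκ]
    refine compProd_prod_eq_zero measurableSet_Iio measurableSet_Ioi ?_
    filter_upwards [ae_eq_zero_or_of_compProd_prod_eq_zero measurableSet_Iio measurableSet_Iio
      measurableSet_Ioi hτ, ae_restrict_of_ae hbar] with y hy ⟨hint, hmean⟩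
    refine hy.elim (fun h0 => measure_mono_null (Ioi_subset_Ioi (hzm.trans hβz.le)) ?_) id
    exact measure_Ioi_eq_zero_of_measure_Iio_eq_zero hint hmean h0
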